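/- A domain in $\mathbb C^n$ is a nonempty connected open subset. Let $\mathcal E$ be the class of all domains $D\subset\mathbb C^n$ that can be exhausted by domains biholomorphic to convex domains, i.e. such that for every compact set $K\subset D$ there is a domain $D'$ with $K\subset D'\subset D$ which is biholomorphic to a convex domain in $\mathbb C^n$. For positive integers $k_1\le k_2\le\dots\le k_n$, a domain $D\subset\mathbb C^n$ is called $(k_1,\dots,k_n)$-balanced if $(\lambda^{k_1}z_1,\dots,\lambda^{k_n}z_n)\in D$ for all $z\in D$ and all $\lambda\in\mathbb C$ with $|\lambda|\le 1$; it is called balanced if $\lambda z\in D$ for all $z\in D$ and all $\lambda\in\mathbb C$ with $|\lambda|\le1$. Theorem. (a) Let $D\in\mathcal E$ be a $(k_1,\dots,k_n)$-balanced domain in $\mathbb C^n$. If $2k_{m+1}>k_n$ for some $m$ with $0\le m\le n-1$, then the intersection $D_m=D\cap\{z_1=\dots=z_m=0\}$ is a convex set (where $D_m=D$ if $m=0$). (b) A balanced domain $D\subset\mathbb C^n$ belongs to $\mathcal E$ if and only if it is convex. -/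

import Mathlib

/-- A domain in `ℂⁿ`: a nonempty connected open set. -/
def IsDomainCn {n : ℕ} (D : Set (Fin n → ℂ)) : Prop :=
  IsOpen D ∧ IsConnected D

/-- The weighted dilation `π_lam (z₁, …, zₙ) = (lam ^ k₁ z₁, …, lam ^ kₙ zₙ)`. -/
def weightedDilation {n : ℕ} (k : Fin n → ℕ) (lam : ℂ) (z : Fin n → ℂ) : Fin n → ℂ :=
  fun j => lam ^ k j * z j

/-- `D` is `(k₁, …, kₙ)`-balanced: `π_lam z ∈ D` for all `lam` in the closed unit disc, `z ∈ D`. -/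
def IsWeightedBalanced {n : ℕ} (k : Fin n → ℕ) (D : Set (Fin n → ℂ)) : Prop :=
  ∀ lam : ℂ, ‖lam‖ ≤ 1 → ∀ z ∈ D, weightedDilation k lam z ∈ D

/-- There is a biholomorphic map of `U` onto `V` (used for open sets `U`, `V`). -/
def IsBiholomorphicTo {n : ℕ} (U V : Set (Fin n → ℂ)) : Prop :=
  ∃ f g : (Fin n → ℂ) → (Fin n → ℂ),
    DifferentiableOn ℂ f U ∧ DifferentiableOn ℂ g V ∧
    Set.MapsTo f U V ∧ Set.MapsTo g V U ∧ Set.InvOn g f U V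

/-- The class `𝓔`: domains `D` that can be exhausted by domains biholomorphic to convex domains,
that is, every compact subset of `D` lies in a domain contained in `D` which is biholomorphic to
a convex domain. -/
def InClassE {n : ℕ} (D : Set (Fin n → ℂ)) : Prop :=
  IsDomainCn D ∧
    ∀ K : Set (Fin n → ℂ), IsCompact K → K ⊆ D →
      ∃ D' G : Set (Fin n → ℂ), IsDomainCn D' ∧ K ⊆ D' ∧ D' ⊆ D ∧
        IsDomainCn G ∧ Convex ℝ G ∧ IsBiholomorphicTo D' G

/-- The slice `D ∩ {z₁ = ⋯ = zₘ = 0}` (all of `D` when `m = 0`). -/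
def coordSlice {n : ℕ} (D : Set (Fin n → ℂ)) (m : ℕ) : Set (Fin n → ℂ) :=
  D ∩ {z | ∀ j : Fin n, (j : ℕ) < m → z j = 0}

/-! For z, w in the slice, take D' ⊂ D containing both closed orbit discs and f : D' → G
biholomorphic onto a convex domain, with inverse g. Average the orbits in G and pull back: h(c) =
g(a f(π_c z) + b f(π_c w)). Since g'f' = id at the origin, h(c) differs from π_c(az + bw) by
O(|c|^(2κ)), where κ is the lowest weight on the slice. As 2κ exceeds every weight, π_{1/c} h(c)
extends over c = 0 with value az + bw, and its boundary lies in D because |1/c| = 1 there. The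
continuity principle `InClassE.mapsTo_closedBall` then puts az + bw in D. Part (b) is the case of
all weights 1 and m = 0; for the converse, a convex domain exhausts itself. -/

open Filter Topology Metric Asymptotics in
/-- A holomorphic map between normed spaces agrees with its affine approximation up to a quadratic
error. -/
theorem isBigO_sub_fderiv_of_differentiableOn {E F : Type*} [NormedAddCommGroup E]
    [NormedSpace ℂ E] [NormedAddCommGroup F] [NormedSpace ℂ F] {f : E → F} {U : Set E} {p : E}
    (hU : IsOpen U) (hp : p ∈ U) (hf : DifferentiableOn ℂ f U) :
    (fun z => f z - f p - fderiv ℂ f p (z - p)) =O[𝓝 p] fun z => ‖z - p‖ ^ 2 := by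
  -- Removing the linear part leaves a map with `h z - h p = o(‖z - p‖)`, so a higher-order Schwarz
  -- lemma gives the quadratic bound.
  set h : E → F := fun z => f z - fderiv ℂ f p (z - p) with hh
  have hdiff : DifferentiableOn ℂ h U := by
    refine hf.sub (Differentiable.differentiableOn ?_)
    fun_prop
  have hhp : h p = f p := by simp [hh]
  have hcont : ContinuousAt h p := hdiff.continuousOn.continuousAt (hU.mem_nhds hp)
  have hev : ∀ᶠ z in 𝓝 p, z ∈ U ∧ h z ∈ closedBall (h p) 1 :=
    (hU.eventually_mem hp).and (hcont.eventually (closedBall_mem_nhds _ one_pos))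
  obtain ⟨r, hr, hball⟩ := Metric.eventually_nhds_iff_ball.1 hev
  have hlittle : (fun z => h z - h p) =o[𝓝 p] fun z => ‖z - p‖ ^ 1 := by
    have := (hf.differentiableAt (hU.mem_nhds hp)).hasFDerivAt.isLittleO
    refine (this.norm_right.congr' (Eventually.of_forall fun z => ?_)
      (Eventually.of_forall fun z => ?_))
    · rw [hhp]; exact sub_right_comm _ _ _
    · simp
  refine IsBigO.of_bound (1 / r ^ 2) ?_
  filter_upwards [ball_mem_nhds p hr] with z hz
  have := Complex.dist_le_mul_div_pow_of_mapsTo_ball_of_isLittleO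
    (hdiff.mono fun z hz => (hball z hz).1) (fun z hz => (hball z hz).2) hlittle hz
  rw [dist_eq_norm, dist_eq_norm, hhp] at this
  have e : f z - f p - fderiv ℂ f p (z - p) = h z - f p := sub_right_comm _ _ _
  rw [e]
  refine this.trans (le_of_eq ?_)
  rw [Real.norm_of_nonneg (by positivity)]
  ring

open Metric in
/-- Maximum principle: a holomorphic disc whose boundary lies in a closed convex set is contained in
that set. -/
theorem mapsTo_closedBall_of_mapsTo_sphere {F : Type*} [NormedAddCommGroup F]
    [NormedSpace ℂ F] {u : ℂ → F} {C : Set F} (hC : IsClosed C) (hconv : Convex ℝ C)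
    (hu : DiffContOnCl ℂ u (ball 0 1)) (hb : Set.MapsTo u (sphere 0 1) C) :
    Set.MapsTo u (closedBall 0 1) C := by
  intro z hz
  by_contra hzC
  obtain ⟨ℓ, c, h1, h2⟩ := RCLike.geometric_hahn_banach_closed_point (𝕜 := ℂ) hconv hC hzC
  -- Exponentiating turns the half-space bound on Re ℓ into a modulus bound.
  have hd : DiffContOnCl ℂ (fun w => Complex.exp (ℓ (u w))) (ball 0 1) :=
    Complex.differentiable_exp.comp_diffContOnCl (ℓ.differentiable.comp_diffContOnCl hu)
  have := Complex.norm_le_of_forall_mem_frontier_norm_le isBounded_ball hd (C := Real.exp c)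
    (fun w hw => by
      rw [frontier_ball _ one_ne_zero] at hw
      rw [Complex.norm_exp]
      exact Real.exp_le_exp.2 (h1 _ (hb hw)).le)
    (z := z) (by rwa [closure_ball _ one_ne_zero])
  rw [Complex.norm_exp, Real.exp_le_exp] at this
  exact absurd h2 (not_lt.2 this)

theorem continuous_weightedDilation {n : ℕ} (k : Fin n → ℕ) :
    Continuous fun p : ℂ × (Fin n → ℂ) => weightedDilation k p.1 p.2 := by
  unfold weightedDilation
  fun_prop

theorem differentiable_weightedDilation_right {n : ℕ} (k : Fin n → ℕ) (c : ℂ) :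
    Differentiable ℂ (weightedDilation k c) := by
  unfold weightedDilation
  fun_prop

theorem differentiable_weightedDilation_left {n : ℕ} (k : Fin n → ℕ) (z : Fin n → ℂ) :
    Differentiable ℂ fun c => weightedDilation k c z := by
  unfold weightedDilation
  fun_prop

theorem weightedDilation_one {n : ℕ} (k : Fin n → ℕ) (z : Fin n → ℂ) :
    weightedDilation k 1 z = z := by
  funext j
  simp [weightedDilation]

theorem weightedDilation_zero {n : ℕ} {k : Fin n → ℕ} (hk : ∀ j, 1 ≤ k j) (z : Fin n → ℂ) :
    weightedDilation k 0 z = 0 := by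
  funext j
  have := Nat.one_le_iff_ne_zero.1 (hk j)
  simp [weightedDilation, this]

/-! ### Continuity principle -/

open Set in
/-- A compact subset of an open convex set of a finite-dimensional space lies in a compact convex
subset. -/
theorem exists_compact_convex_between {E : Type*} [NormedAddCommGroup E] [NormedSpace ℝ E]
    [FiniteDimensional ℝ E] {L G : Set E} (hL : IsCompact L) (hG : IsOpen G) (hconv : Convex ℝ G)
    (hLG : L ⊆ G) : ∃ C : Set E, IsCompact C ∧ Convex ℝ C ∧ L ⊆ C ∧ C ⊆ G := by
  have hpt : ∀ x ∈ L, ∃ t : Set E, t.Finite ∧ t ⊆ G ∧ x ∈ interior (convexHull ℝ t) := by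
    intro x hx
    obtain ⟨t, ht, htG⟩ :=
      (convex_singleton x).exists_subset_interior_convexHull_finset_of_isCompact
        isCompact_singleton (by rw [nhdsSet_singleton]; exact hG.mem_nhds (hLG hx))
    exact ⟨t, t.finite_toSet, (subset_convexHull ℝ _).trans htG, ht rfl⟩
  choose! t ht htG htx using hpt
  obtain ⟨s, hsL, hs⟩ := hL.elim_nhds_subcover (fun x => interior (convexHull ℝ (t x)))
    fun x hx => isOpen_interior.mem_nhds (htx x hx)
  refine ⟨convexHull ℝ (⋃ x ∈ s, t x),
    (s.finite_toSet.biUnion fun x hx => ht x (hsL x hx)).isCompact_convexHull ℝ,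
    convex_convexHull ℝ _, fun x hx => ?_,
    convexHull_min (iUnion₂_subset fun x hx => htG x (hsL x hx)) hconv⟩
  obtain ⟨y, hy, hxy⟩ := mem_iUnion₂.1 (hs hx)
  exact convexHull_mono (subset_biUnion_of_mem (u := t) hy) (interior_subset hxy)

open Metric Set in
/-- Continuity principle: a weighted balanced domain of the class `𝓔` contains every holomorphic
disc whose boundary it contains. -/
theorem InClassE.mapsTo_closedBall {n : ℕ} {k : Fin n → ℕ} {D : Set (Fin n → ℂ)}
    (hk : ∀ j, 1 ≤ k j) (hE : InClassE D) (hD : IsWeightedBalanced k D) {u : ℂ → Fin n → ℂ}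
    (hu : DiffContOnCl ℂ u (ball 0 1)) (hb : MapsTo u (sphere 0 1) D) :
    MapsTo u (closedBall 0 1) D := by
  have huc : ContinuousOn u (closedBall 0 1) := hu.continuousOn_ball
  set T : ℝ × ℂ → Fin n → ℂ := fun q => weightedDilation k (q.1 : ℂ) (u q.2) with hT
  have hTc : ContinuousOn T (univ ×ˢ closedBall 0 1) := by
    refine (continuous_weightedDilation k).comp_continuousOn (ContinuousOn.prodMk ?_ ?_)
    · exact (Complex.continuous_ofReal.comp continuous_fst).continuousOn
    · exact huc.comp continuousOn_snd fun q hq => hq.2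
  -- The boundaries of all the shrunken discs form one compact set, so a single D' serves for every
  -- s.
  set L : Set (Fin n → ℂ) := T '' (Icc 0 1 ×ˢ sphere 0 1) with hL
  have hLc : IsCompact L := (isCompact_Icc.prod (isCompact_sphere _ _)).image_of_continuousOn
    (hTc.mono (prod_mono (subset_univ _) sphere_subset_closedBall))
  have hLD : L ⊆ D := by
    rintro _ ⟨⟨s, w⟩, ⟨hs, hw⟩, rfl⟩
    refine hD s ?_ _ (hb hw)
    rw [Complex.norm_real, Real.norm_of_nonneg hs.1]
    exact hs.2
  obtain ⟨D', G, ⟨hD'o, -⟩, hLD', hD'D, ⟨hGo, -⟩, hGc, f, g, hf, hg, hfm, hgm, hinv⟩ :=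
    hE.2 L hLc hLD
  obtain ⟨C, hCc, hCconv, hfC, hCG⟩ := exists_compact_convex_between
    (hLc.image_of_continuousOn (hf.continuousOn.mono hLD')) hGo hGc
    (hfm.mono_left hLD').image_subset
  have hgC : IsCompact (g '' C) := hCc.image_of_continuousOn (hg.continuousOn.mono hCG)
  have hgCD' : g '' C ⊆ D' := (hgm.mono_left hCG).image_subset
  -- A disc lying in D' is forced into the fixed compact set `g '' C`, so being in D' is both an
  -- open and a closed condition on s.
  have key : ∀ s ∈ Icc (0 : ℝ) 1, (∀ w ∈ closedBall (0 : ℂ) 1, T (s, w) ∈ D') →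
      ∀ w ∈ closedBall (0 : ℂ) 1, T (s, w) ∈ g '' C := by
    intro s hs hsD' w hw
    have hTs : DiffContOnCl ℂ (fun w => T (s, w)) (ball 0 1) :=
      (differentiable_weightedDilation_right k (s : ℂ)).comp_diffContOnCl hu
    have hfT : DiffContOnCl ℂ (fun w => f (T (s, w))) (ball 0 1) := by
      refine ⟨hf.comp hTs.differentiableOn fun w hw => hsD' w (ball_subset_closedBall hw), ?_⟩
      rw [closure_ball _ one_ne_zero]
      exact hf.continuousOn.comp hTs.continuousOn_ball hsD'
    refine ⟨f (T (s, w)), mapsTo_closedBall_of_mapsTo_sphere hCc.isClosed hCconv hfT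
      (fun w hw => hfC ⟨_, ⟨(s, w), ⟨hs, hw⟩, rfl⟩, rfl⟩) hw, hinv.1 (hsD' w hw)⟩
  set S : Set ℝ := {s | ∀ w ∈ closedBall (0 : ℂ) 1, T (s, w) ∈ g '' C} with hS
  have hTs : ∀ w ∈ closedBall (0 : ℂ) 1, Continuous fun s => T (s, w) := fun w _ =>
    (continuous_weightedDilation k).comp
      (Complex.continuous_ofReal.prodMk (continuous_const (y := u w)))
  have hSclosed : IsClosed S := by
    have : S = ⋂ w ∈ closedBall (0 : ℂ) 1, (fun s => T (s, w)) ⁻¹' (g '' C) := by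
      ext s; simp [hS]
    rw [this]
    exact isClosed_biInter fun w hw => hgC.isClosed.preimage (hTs w hw)
  have h0 : (0 : ℝ) ∈ S := by
    refine key 0 ⟨le_rfl, zero_le_one⟩ fun w _ =>
      hLD' ⟨(0, 1), ⟨⟨le_rfl, zero_le_one⟩, by simp⟩, ?_⟩
    simp only [hT, Complex.ofReal_zero, weightedDilation_zero hk]
  have h1 : (1 : ℝ) ∈ S := by
    refine (hSclosed.inter isClosed_Icc).Icc_subset_of_forall_mem_nhdsWithin h0 (fun s hs => ?_)
      (right_mem_Icc.2 zero_le_one)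
    have hopen : IsOpen {s | ∀ w ∈ closedBall (0 : ℂ) 1, T (s, w) ∈ D'} := by
      have hres : Continuous fun q : ℝ × closedBall (0 : ℂ) 1 => T (q.1, q.2) :=
        hTc.comp_continuous (by fun_prop) fun q => ⟨mem_univ _, q.2.2⟩
      refine isOpen_iff_eventually.2 fun s hs => ?_
      have := isCompact_univ.eventually_forall_of_forall_eventually (x₀ := s)
        (P := fun r (w : closedBall (0 : ℂ) 1) => T (r, w) ∈ D')
        fun w _ => hres.continuousAt.eventually (hD'o.mem_nhds (hs w w.2))
      filter_upwards [this] with r hr w hw using hr ⟨w, hw⟩ (mem_univ _)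
    filter_upwards [mem_nhdsWithin_of_mem_nhds (hopen.mem_nhds fun w hw => hgCD' (hs.1 w hw)),
      Ioo_mem_nhdsGT hs.2.2] with r hr hr'
    exact key r ⟨hs.2.1.trans hr'.1.le, hr'.2.le⟩ hr
  intro w hw
  have := hD'D (hgCD' (h1 w hw))
  simpa only [hT, Complex.ofReal_one, weightedDilation_one] using this

/-! ### Averaging orbits -/

open Filter Topology Asymptotics in
theorem isBigO_pow_pow_of_le {a b : ℕ} (hab : a ≤ b) :
    (fun c : ℂ => c ^ b) =O[𝓝 0] fun c : ℂ => c ^ a := by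
  refine IsBigO.of_bound 1 ?_
  filter_upwards [Metric.closedBall_mem_nhds (0 : ℂ) one_pos] with c hc
  rw [norm_pow, norm_pow, one_mul]
  exact pow_le_pow_of_le_one (norm_nonneg c) (mem_closedBall_zero_iff.1 hc) hab

open Filter Topology Asymptotics in
theorem isBigO_weightedDilation {n : ℕ} {k : Fin n → ℕ} {κ : ℕ} {z : Fin n → ℂ}
    (hz : ∀ j, z j ≠ 0 → κ ≤ k j) :
    (fun c => weightedDilation k c z) =O[𝓝 0] fun c : ℂ => ‖c‖ ^ κ := by
  refine isBigO_pi.2 fun j => ?_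
  by_cases hj : z j = 0
  · simp [weightedDilation, hj, isBigO_zero]
  · have : (fun c : ℂ => c ^ k j) =O[𝓝 0] fun c : ℂ => c ^ κ := isBigO_pow_pow_of_le (hz j hj)
    simpa [weightedDilation, mul_comm] using (this.const_mul_left (z j)).norm_right

open Filter Topology Asymptotics Set in
/-- The holomorphic average of two weighted orbits in a domain biholomorphic to a convex one agrees
with the orbit of the average up to twice the lowest weight involved. -/
theorem isBigO_average_sub_weightedDilation {n : ℕ} {k : Fin n → ℕ} {κ : ℕ}
    {z w : Fin n → ℂ} (hk : ∀ j, 1 ≤ k j) (hz : ∀ j, z j ≠ 0 → κ ≤ k j)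
    (hw : ∀ j, w j ≠ 0 → κ ≤ k j) {U V : Set (Fin n → ℂ)} {f g : (Fin n → ℂ) → Fin n → ℂ}
    (hU : IsOpen U) (hV : IsOpen V) (h0 : (0 : Fin n → ℂ) ∈ U) (hf : DifferentiableOn ℂ f U)
    (hg : DifferentiableOn ℂ g V) (hfm : MapsTo f U V) (hinv : LeftInvOn g f U)
    {a b : ℝ} (hab : a + b = 1) :
    (fun c => g (a • f (weightedDilation k c z) + b • f (weightedDilation k c w)) -
      weightedDilation k c (a • z + b • w)) =O[𝓝 0] fun c : ℂ => ‖c‖ ^ (2 * κ) := by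
  set A := fderiv ℂ f 0
  set B := fderiv ℂ g (f 0)
  have hBA : ∀ v, B (A v) = v := by
    intro v
    have h1 : HasFDerivAt (g ∘ f) (B.comp A) 0 :=
      ((hg.differentiableAt (hV.mem_nhds (hfm h0))).hasFDerivAt).comp 0
        (hf.differentiableAt (hU.mem_nhds h0)).hasFDerivAt
    have h2 : HasFDerivAt (g ∘ f) (ContinuousLinearMap.id ℂ (Fin n → ℂ)) 0 := by
      refine (hasFDerivAt_id _).congr_of_eventuallyEq ?_
      filter_upwards [hU.mem_nhds h0] with x hx using hinv hx
    exact DFunLike.congr_fun (h1.unique h2) v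
  -- The orbit is O(|c|^κ), so the quadratic error of `f` along it is O(|c|^(2κ)).
  have horb : ∀ v : Fin n → ℂ, (∀ j, v j ≠ 0 → κ ≤ k j) →
      (fun c => f (weightedDilation k c v) - f 0 - A (weightedDilation k c v)) =O[𝓝 0]
        fun c : ℂ => ‖c‖ ^ (2 * κ) := by
    intro v hv
    have ht : Tendsto (fun c => weightedDilation k c v) (𝓝 0) (𝓝 0) := by
      simpa only [weightedDilation_zero hk] using
        (differentiable_weightedDilation_left k v).continuous.tendsto 0
    have h1 := (isBigO_sub_fderiv_of_differentiableOn hU h0 hf).comp_tendsto ht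
    have h2 := (isBigO_weightedDilation hv).norm_left.pow 2
    simp only [Function.comp_def, sub_zero] at h1
    refine h1.trans (h2.congr_right fun c => ?_)
    rw [← pow_mul, mul_comm]
  set x := a • z + b • w with hx
  have hxκ : ∀ j, x j ≠ 0 → κ ≤ k j := by
    intro j hj
    by_contra hlt
    have h1 : z j = 0 := by_contra fun h => hlt (hz j h)
    have h2 : w j = 0 := by_contra fun h => hlt (hw j h)
    exact hj (by simp [hx, h1, h2])
  have hlin : ∀ c, weightedDilation k c x =
      a • weightedDilation k c z + b • weightedDilation k c w := by
    intro c
    ext j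
    simp [weightedDilation, hx]
    ring
  set y : ℂ → Fin n → ℂ := fun c => a • f (weightedDilation k c z) + b • f (weightedDilation k c w)
    with hy
  have hyO : (fun c => y c - f 0 - A (weightedDilation k c x)) =O[𝓝 0]
      fun c : ℂ => ‖c‖ ^ (2 * κ) := by
    refine (((horb z hz).const_smul_left a).add ((horb w hw).const_smul_left b)).congr_left
      fun c => ?_
    have hA : A (weightedDilation k c x) =
        a • A (weightedDilation k c z) + b • A (weightedDilation k c w) := by
      rw [hlin, map_add, A.map_smul_of_tower, A.map_smul_of_tower]
    have hf0 : f 0 = a • f 0 + b • f 0 := by rw [← add_smul, hab, one_smul]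
    rw [hA, hy]
    nth_rewrite 3 [hf0]
    simp only [Pi.smul_apply, smul_sub]
    abel
  have hyO' : (fun c => y c - f 0) =O[𝓝 0] fun c : ℂ => ‖c‖ ^ κ := by
    have h1 := (A.isBigO_comp (fun c => weightedDilation k c x) (𝓝 0)).trans
      (isBigO_weightedDilation hxκ)
    have h2 : (fun c : ℂ => ‖c‖ ^ (2 * κ)) =O[𝓝 0] fun c : ℂ => ‖c‖ ^ κ := by
      have : (fun c : ℂ => c ^ (2 * κ)) =O[𝓝 0] fun c : ℂ => c ^ κ :=
        isBigO_pow_pow_of_le (by omega)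
      simpa using this.norm_norm
    exact ((hyO.trans h2).add h1).congr_left fun c => by abel
  have hyt : Tendsto y (𝓝 0) (𝓝 (f 0)) := by
    have hfc : ∀ v, Tendsto (fun c => f (weightedDilation k c v)) (𝓝 0) (𝓝 (f 0)) := by
      intro v
      refine (hf.continuousOn.continuousAt (hU.mem_nhds h0)).tendsto.comp ?_
      simpa only [weightedDilation_zero hk] using
        (differentiable_weightedDilation_left k v).continuous.tendsto 0
    have := ((hfc z).const_smul a).add ((hfc w).const_smul b)
    rwa [← add_smul, hab, one_smul] at this
  have hgO := (isBigO_sub_fderiv_of_differentiableOn hV (hfm h0) hg).comp_tendsto hyt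
  have hgO' := hgO.trans ((hyO'.norm_left.pow 2).congr_right fun c => by rw [← pow_mul, mul_comm])
  have hBO := (B.isBigO_comp _ _).trans hyO
  refine (hgO'.add hBO).congr_left fun c => ?_
  simp only [Function.comp_def, map_sub, hBA, hinv h0]
  abel

open Metric Set Filter Topology Asymptotics in
/-- A weighted balanced domain of the class `𝓔` contains the segment between two of its points
whose nonzero coordinates have weights more than half of every weight. -/
theorem InClassE.average_mem {n : ℕ} {k : Fin n → ℕ} {κ : ℕ} {D : Set (Fin n → ℂ)}
    (hk : ∀ j, 1 ≤ k j) (hE : InClassE D) (hD : IsWeightedBalanced k D) (hκ : ∀ j, k j < 2 * κ)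
    {z w : Fin n → ℂ} (hzD : z ∈ D) (hwD : w ∈ D) (hz : ∀ j, z j ≠ 0 → κ ≤ k j)
    (hw : ∀ j, w j ≠ 0 → κ ≤ k j) {a b : ℝ} (ha : 0 ≤ a) (hb : 0 ≤ b) (hab : a + b = 1) :
    a • z + b • w ∈ D := by
  set O : (Fin n → ℂ) → ℂ → Fin n → ℂ := fun v c => weightedDilation k c v with hO
  have hOd : ∀ v, Differentiable ℂ (O v) := differentiable_weightedDilation_left k
  have hK : IsCompact (O z '' closedBall 0 1 ∪ O w '' closedBall 0 1) :=
    ((isCompact_closedBall _ _).image (hOd z).continuous).union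
      ((isCompact_closedBall _ _).image (hOd w).continuous)
  obtain ⟨D', G, ⟨hD'o, -⟩, hKD', hD'D, ⟨hGo, -⟩, hGc, f, g, hf, hg, hfm, hgm, hinv⟩ :=
    hE.2 _ hK (by
      rintro _ (⟨c, hc, rfl⟩ | ⟨c, hc, rfl⟩)
      · exact hD c (mem_closedBall_zero_iff.1 hc) _ hzD
      · exact hD c (mem_closedBall_zero_iff.1 hc) _ hwD)
  have hzD' : ∀ c ∈ closedBall (0 : ℂ) 1, O z c ∈ D' := fun c hc => hKD' (.inl ⟨c, hc, rfl⟩)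
  have hwD' : ∀ c ∈ closedBall (0 : ℂ) 1, O w c ∈ D' := fun c hc => hKD' (.inr ⟨c, hc, rfl⟩)
  have h0 : (0 : Fin n → ℂ) ∈ D' := by
    simpa only [hO, weightedDilation_zero hk] using hzD' 0 (by simp)
  set U : Set ℂ := O z ⁻¹' D' ∩ O w ⁻¹' D' with hUdef
  have hUo : IsOpen U :=
    (hD'o.preimage (hOd z).continuous).inter (hD'o.preimage (hOd w).continuous)
  have hBU : closedBall (0 : ℂ) 1 ⊆ U := fun c hc => ⟨hzD' c hc, hwD' c hc⟩
  set y : ℂ → Fin n → ℂ := fun c => a • f (O z c) + b • f (O w c) with hy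
  have hyG : MapsTo y U G := fun c hc => hGc (hfm hc.1) (hfm hc.2) ha hb hab
  have hyd : DifferentiableOn ℂ y U :=
    ((hf.comp (hOd z).differentiableOn fun c hc => hc.1).const_smul a).add
      ((hf.comp (hOd w).differentiableOn fun c hc => hc.2).const_smul b)
  set h : ℂ → Fin n → ℂ := fun c => g (y c) with hh
  have hhd : DifferentiableOn ℂ h U := hg.comp hyd hyG
  set x := a • z + b • w with hx
  have hO2 : (fun c => h c - weightedDilation k c x) =O[𝓝 0] fun c : ℂ => ‖c‖ ^ (2 * κ) :=
    isBigO_average_sub_weightedDilation hk hz hw hD'o hGo h0 hf hg hfm hinv.1 hab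
  set u : ℂ → Fin n → ℂ := Function.update (fun c => weightedDilation k c⁻¹ (h c)) 0 x with hu
  have hune : ∀ c ≠ 0, u c = weightedDilation k c⁻¹ (h c) := fun c hc => by simp [hu, hc]
  have hu0 : u 0 = x := by simp [hu]
  have hucont : ContinuousAt u 0 := by
    rw [hu, continuousAt_update_same, tendsto_pi_nhds]
    intro j
    -- The strict inequality k_j < 2κ leaves a spare factor c after division by c^(k_j), so the
    -- limit at 0 is exactly `x j`.
    have h1 : (fun c => h c j - c ^ k j * x j) =O[𝓝[≠] 0] fun c : ℂ => c ^ (k j + 1) := by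
      have h2 : (fun c : ℂ => c ^ (2 * κ)) =O[𝓝 0] fun c : ℂ => c ^ (k j + 1) :=
        isBigO_pow_pow_of_le (hκ j)
      refine IsBigO.mono ?_ nhdsWithin_le_nhds
      refine ((isBigO_pi.1 hO2 j).trans ?_)
      simpa using h2.norm_left
    have h3 := (isBigO_refl (fun c : ℂ => c⁻¹ ^ k j) (𝓝[≠] 0)).mul h1
    have h4 : (fun c : ℂ => c⁻¹ ^ k j * h c j - x j) =O[𝓝[≠] 0] fun c : ℂ => c := by
      refine h3.congr' ?_ ?_
      · filter_upwards [self_mem_nhdsWithin] with c hc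
        have : c ^ k j ≠ 0 := pow_ne_zero _ hc
        rw [inv_pow]
        field_simp
      · filter_upwards [self_mem_nhdsWithin] with c hc
        have : c ^ k j ≠ 0 := pow_ne_zero _ hc
        rw [inv_pow, pow_succ]
        field_simp
    have h5 : Tendsto (fun c : ℂ => c) (𝓝[≠] 0) (𝓝 0) := tendsto_id.mono_left nhdsWithin_le_nhds
    exact tendsto_sub_nhds_zero_iff.1 (h4.trans_tendsto h5)
  have hud : DifferentiableOn ℂ u U := by
    refine (Complex.differentiableOn_compl_singleton_and_continuousAt_iff
      (hUo.mem_nhds (hBU (by simp)))).1 ⟨?_, hucont⟩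
    have : DifferentiableOn ℂ (fun c => weightedDilation k c⁻¹ (h c)) (U \ {0}) := by
      refine differentiableOn_pi.2 fun j => DifferentiableOn.mul ?_ ?_
      · exact (differentiableOn_inv.mono fun c hc => hc.2).pow _
      · exact differentiableOn_pi.1 (hhd.mono sdiff_subset) j
    exact this.congr fun c hc => hune c hc.2
  have hmaps : MapsTo u (closedBall 0 1) D := by
    refine hE.mapsTo_closedBall hk hD (hud.mono ?_).diffContOnCl fun c hc => ?_
    · rwa [closure_ball _ one_ne_zero]
    · have hc1 : ‖c‖ = 1 := mem_sphere_zero_iff_norm.1 hc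
      rw [hune c (norm_ne_zero_iff.1 (by simp [hc1]))]
      exact hD _ (by simp [hc1]) _ (hD'D (hgm (hyG (hBU (sphere_subset_closedBall hc)))))
  simpa only [hu0] using hmaps (mem_closedBall_self zero_le_one)

/-! ### Convexity of slices -/

/-- Nonzero coordinates of slice points have 0-based index at least m, hence weight at least κ = `k
⟨m, hm⟩` by monotonicity. -/
theorem InClassE.convex_coordSlice {n : ℕ} {k : Fin n → ℕ} {D : Set (Fin n → ℂ)}
    (hk : ∀ j, 1 ≤ k j) (hmono : Monotone k) (hE : InClassE D) (hD : IsWeightedBalanced k D)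
    {m : ℕ} (hm : m < n) (hkm : ∀ j, k j < 2 * k ⟨m, hm⟩) :
    Convex ℝ (coordSlice D m) := by
  have hlow : ∀ v ∈ coordSlice D m, ∀ j, v j ≠ 0 → k ⟨m, hm⟩ ≤ k j := fun v hv j hj =>
    hmono (Fin.le_def.2 (not_lt.1 fun h => hj (hv.2 j h)))
  intro z hz w hw a b ha hb hab
  refine ⟨hE.average_mem hk hD hkm hz.1 hw.1 (hlow z hz) (hlow w hw) ha hb hab, fun j hj => ?_⟩
  simp [hz.2 j hj, hw.2 j hj]

theorem IsDomainCn.inClassE_of_convex {n : ℕ} {D : Set (Fin n → ℂ)} (hD : IsDomainCn D)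
    (hconv : Convex ℝ D) : InClassE D :=
  ⟨hD, fun _ _ hKD => ⟨D, D, hD, hKD, subset_rfl, hD, hconv, id, id, differentiableOn_id,
    differentiableOn_id, Set.mapsTo_id D, Set.mapsTo_id D, fun _ _ => rfl, fun _ _ => rfl⟩⟩

theorem Balanced.isWeightedBalanced_one {n : ℕ} {D : Set (Fin n → ℂ)} (hD : Balanced ℂ D) :
    IsWeightedBalanced (fun _ => 1) D := by
  intro c hc z hz
  have : weightedDilation (fun _ => 1) c z = c • z := by
    ext j
    simp [weightedDilation]
  rw [this]
  exact hD.smul_mem hc hz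

theorem theoremb :
    (∀ (n : ℕ) (k : Fin n → ℕ) (D : Set (Fin n → ℂ)),
      (∀ j, 1 ≤ k j) → Monotone k → InClassE D → IsWeightedBalanced k D →
        ∀ (m : ℕ) (hm : m < n), k ⟨n - 1, by omega⟩ < 2 * k ⟨m, hm⟩ →
          Convex ℝ (coordSlice D m)) ∧
    (∀ (n : ℕ) (D : Set (Fin n → ℂ)), IsDomainCn D → Balanced ℂ D →
      (InClassE D ↔ Convex ℝ D)) := by
  refine ⟨fun n k D hk hmono hE hD m hm hkm =>
      hE.convex_coordSlice hk hmono hD hm fun j =>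
        (hmono (Fin.le_def.2 (Nat.le_sub_one_of_lt j.2))).trans_lt hkm,
    fun n D hdom hD => ⟨fun hE => ?_, hdom.inClassE_of_convex⟩⟩
  -- The slice result needs m < n, so m = 0 is unavailable in dimension zero.
  rcases Nat.eq_zero_or_pos n with rfl | hn
  · exact (Set.subsingleton_of_subsingleton).convex
  · have := hE.convex_coordSlice (fun _ => le_rfl) monotone_const hD.isWeightedBalanced_one hn
      fun _ => one_lt_two
    simpa [coordSlice] using this
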